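/- Let $N\ge 1$ and let $\theta\in\mathbb R$ satisfy $2\tan^{-1}(2^{1/N}-1)\le\theta<\pi/2$. Each of $N$ independent senders receives a uniformly distributed bit $x_i\in\{0,1\}$ and sends a message (a finite-dimensional quantum state $\rho^{(i)}_{x_i}$, or a classical message from a finite alphabet drawn according to $p_e^{(i)}(m_i|x_i)$) to a receiver, who outputs $z\in\{0,1\}^N$ by a joint POVM on $\bigotimes_i\rho^{(i)}_{x_i}$, respectively by a conditional distribution $p_d(z|m_1,\dots,m_N)$. The success metric is $$\widetilde{\mathcal S}=1-\sum_{x\in\{0,1\}^N}2^{-N}\,p(z=x\,|\,x).$$ The anti-distinguishability of a sender's inputs is $1-\min_M\sum_z\min_{x\in\{0,1\}}\tfrac12\,p(z|x,M)$, where the minimum is over all measurements $M$ (POVMs, respectively stochastic decodings) of that sender's message with finitely many outcomes $z$. For a bound $A$ imposed on the anti-distinguishability of every sender, let $\widetilde{\mathcal S}_C(A)$ and $\widetilde{\mathcal S}_Q(A)$ be the maximum of $\widetilde{\mathcal S}$ over classical and over quantum protocols. Let $|\psi_x\rangle=\cos(\theta/2)|0\rangle+(-1)^{x}\sin(\theta/2)|1\rangle$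 for $x\in\{0,1\}$. Then: 1. The $2^N$ product states $|\psi_{x_1}\rangle\otimes\cdots\otimes|\psi_{x_N}\rangle$ are perfectly anti-distinguishable: there is a POVM $\{M_x\}_{x\in\{0,1\}^N}$ such that $M_x$ has probability $0$ on the product state labelled by $x$, for every $x$. Hence the maximum of $\widetilde{\mathcal S}$ over the receiver's measurements of these states is $1$. 2. The anti-distinguishability of each sender's inputs in this protocol is $A^Q=\frac12(1+\sin\theta)$ (the minimum that defines it is attained), and $\widetilde{\mathcal S}_Q(A^Q)=1$. 3. The least $A$ with $\widetilde{\mathcal S}_C(A)=1$ exists and is $A^C=1$. 4. Consequently $$\left(\frac{A^C}{A^Q}\right)^N=\left(\frac{2}{1+\sin\theta}\right)^N>1 .$$ -/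

import Mathlib

open scoped ComplexOrder

/-- `p x z` is the probability of outcome `z` given `x`: nonnegative and normalised. -/
def IsStochastic {X Z : Type} [Fintype Z] (p : X → Z → ℝ) : Prop :=
  (∀ x z, 0 ≤ p x z) ∧ ∀ x, ∑ z, p x z = 1

/-- Density matrices. -/
def IsDensity {ι : Type} [Fintype ι] (ρ : Matrix ι ι ℂ) : Prop :=
  ρ.PosSemidef ∧ ρ.trace = 1

/-- Positive-operator-valued measures with outcome set `Z`. -/
def IsPOVM {ι Z : Type} [DecidableEq ι] [Fintype Z] (M : Z → Matrix ι ι ℂ) : Prop :=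
  (∀ z, (M z).PosSemidef) ∧ ∑ z, M z = 1

/-- The Born rule `p(z|x) = Tr (ρ_x M_z)`. -/
noncomputable def born {ι X Z : Type} [Fintype ι] (ρ : X → Matrix ι ι ℂ)
    (M : Z → Matrix ι ι ℂ) (x : X) (z : Z) : ℝ :=
  ((ρ x * M z).trace).re

/-- The density matrix `|ψ⟩⟨ψ|`. -/
def pureState {ι : Type} (ψ : ι → ℂ) : Matrix ι ι ℂ :=
  Matrix.vecMulVec ψ (star ψ)

/-- The tensor (Kronecker) product of `N` matrices, on the product of the index sets. -/
def tensor {N : ℕ} {ι : Fin N → Type} (ρ : ∀ i, Matrix (ι i) (ι i) ℂ) :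
    Matrix (∀ i, ι i) (∀ i, ι i) ℂ :=
  Matrix.of fun a b => ∏ i, ρ i (a i) (b i)

/-- The error `∑_z min_x q_x p(z|x)` of anti-distinguishing `x`, sampled from `q`, with the
statistics `p`: on outcome `z` one names the least likely input. -/
noncomputable def exclusionError {X Z : Type} [Fintype Z] (q : X → ℝ) (p : X → Z → ℝ) : ℝ :=
  ∑ z, ⨅ x, q x * p x z

/-- All values of the exclusion error that measurements (with any finite number of outcomes)
reach on the ensemble of quantum states `ρ_x` with prior `q`. -/
def quantumExclusionErrors {ι X : Type} [Fintype ι] [DecidableEq ι] (q : X → ℝ)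
    (ρ : X → Matrix ι ι ℂ) : Set ℝ :=
  {e | ∃ (k : ℕ) (M : Fin k → Matrix ι ι ℂ), IsPOVM M ∧ e = exclusionError q (born ρ M)}

/-- Anti-distinguishability `1 - min_M ∑_z min_x q_x Tr (ρ_x M_z)` of quantum states. -/
noncomputable def quantumAntiDist {ι X : Type} [Fintype ι] [DecidableEq ι] (q : X → ℝ)
    (ρ : X → Matrix ι ι ℂ) : ℝ :=
  1 - sInf (quantumExclusionErrors q ρ)

/-- All values of the exclusion error that decodings `d` (with any finite number of outcomes) of
the classical message, encoded by `e`, reach for the prior `q`. -/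
def classicalExclusionErrors {X Msg : Type} [Fintype Msg] (q : X → ℝ)
    (e : X → Msg → ℝ) : Set ℝ :=
  {r | ∃ (k : ℕ) (d : Msg → Fin k → ℝ), IsStochastic d ∧
    r = exclusionError q (fun x z => ∑ m, d m z * e x m)}

/-- Anti-distinguishability `1 - min_M ∑_z min_x q_x p(z|x,M)` of classically encoded inputs. -/
noncomputable def classicalAntiDist {X Msg : Type} [Fintype Msg] (q : X → ℝ)
    (e : X → Msg → ℝ) : ℝ :=
  1 - sInf (classicalExclusionErrors q e)

/-- The success metric `1 - ∑_x q_x p(z = x | x)` of anti-distinguishing the inputs distributed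
among `N` independent senders, each with prior `q`. -/
noncomputable def successMetric {X : Type} [Fintype X] {N : ℕ} (q : X → ℝ)
    (p : (Fin N → X) → (Fin N → X) → ℝ) : ℝ :=
  1 - ∑ x : Fin N → X, (∏ i, q (x i)) * p x x

/-- The values of the success metric reached by classical protocols with `N` senders: sender `i`
encodes the input by `e i` into a message from a finite alphabet such that its
anti-distinguishability is at most `A`, and the receiver decodes the messages by `d`. -/
def classicalSuccessValues {X : Type} [Fintype X] [DecidableEq X] (N : ℕ) (q : X → ℝ) (A : ℝ) :
    Set ℝ :=
  {S | ∃ (k : Fin N → ℕ) (e : ∀ i, X → Fin (k i) → ℝ)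
      (d : (∀ i, Fin (k i)) → (Fin N → X) → ℝ),
    (∀ i, IsStochastic (e i)) ∧ IsStochastic d ∧ (∀ i, classicalAntiDist q (e i) ≤ A) ∧
    S = successMetric q (fun x z => ∑ m, d m z * ∏ i, e i (x i) (m i))}

/-- The values of the success metric reached by quantum protocols with `N` senders: sender `i`
sends a state `ρ i x` of a finite-dimensional system such that the anti-distinguishability is at
most `A`, and the receiver measures the product state. -/
def quantumSuccessValues {X : Type} [Fintype X] [DecidableEq X] (N : ℕ) (q : X → ℝ) (A : ℝ) :
    Set ℝ :=
  {S | ∃ (k : Fin N → ℕ) (ρ : ∀ i, X → Matrix (Fin (k i)) (Fin (k i)) ℂ)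
      (M : (Fin N → X) → Matrix (∀ i, Fin (k i)) (∀ i, Fin (k i)) ℂ),
    (∀ i x, IsDensity (ρ i x)) ∧ IsPOVM M ∧ (∀ i, quantumAntiDist q (ρ i) ≤ A) ∧
    S = successMetric q (born (fun x => tensor (fun i => ρ i (x i))) M)}

/-- The anti-distinguishability bounds (common to all senders) under which the best classical
success metric equals `S`. -/
def classicalBoundsAchieving {X : Type} [Fintype X] [DecidableEq X] (N : ℕ) (q : X → ℝ) (S : ℝ) :
    Set ℝ :=
  {A | IsGreatest (classicalSuccessValues N q A) S}

/-- The anti-distinguishability of each sender's input that is required classically for the best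
success metric to equal `S`. -/
noncomputable def requiredClassicalAntiDist {X : Type} [Fintype X] [DecidableEq X] (N : ℕ)
    (q : X → ℝ) (S : ℝ) : ℝ :=
  sInf (classicalBoundsAchieving N q S)

/-- Equiprobable binary inputs. -/
noncomputable def uniformBit : Fin 2 → ℝ := fun _ => 1 / 2

/-- The qubit state `cos(θ/2)|0⟩ + (-1)^x sin(θ/2)|1⟩`. -/
noncomputable def pbrVector (θ : ℝ) (x : Fin 2) : Fin 2 → ℂ :=
  ![(Real.cos (θ / 2) : ℂ), (-1) ^ (x : ℕ) * (Real.sin (θ / 2) : ℂ)]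

/-- Its density matrix. -/
noncomputable def pbrState (θ : ℝ) (x : Fin 2) : Matrix (Fin 2) (Fin 2) ℂ :=
  pureState (pbrVector θ x)

/-- The density matrix of the `N`-qubit product state for the input string `x`. -/
noncomputable def pbrProduct {N : ℕ} (θ : ℝ) (x : Fin N → Fin 2) :
    Matrix (Fin N → Fin 2) (Fin N → Fin 2) ℂ :=
  tensor (ι := fun _ => Fin 2) (fun i => pbrState θ (x i))

open Matrix

/-! Put `t = tan (θ / 2)`; the range of `θ` gives `0 ≤ t ≤ 1` and `2 ≤ (1 + t) ^ N`. The product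
vectors are the sign twists `(-1)^(x·z)` of the one with `x = 0`. If a vector `u` of phases is
orthogonal to that one, the normalised twists of `u` form an orthonormal basis by character
orthogonality, and the `x`-th is orthogonal to the `x`-th product vector (`isPOVM_signTwist`,
`trace_pbrProduct_mul_signTwist`). Such a `u` exists when the complex numbers `t ^ |z|`, suitably
rotated, sum to zero (`exists_phases_sum_eq_zero`).

For one sender, naming the less likely of two inputs is ordinary state discrimination, so the
minimal error is Helstrom's `(1 - sin θ) / 2`.

Classically, suppose that each sender has a message possible under both inputs. The tuple of these
messages is possible under every `x`, so no answer to it is free of error. Hence under a perfect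
protocol some sender has perfectly anti-distinguishable inputs, which forces the bound `1`. -/

open scoped MatrixOrder in
theorem Matrix.PosSemidef.exists_eq_conjTranspose_mul_self {ι : Type} [Fintype ι]
    {A : Matrix ι ι ℂ} (hA : A.PosSemidef) : ∃ B : Matrix ι ι ℂ, A = Bᴴ * B := by
  classical
  exact CStarAlgebra.nonneg_iff_eq_star_mul_self.mp hA.nonneg

theorem tensor_conjTranspose_mul_self {N : ℕ} {ι : Fin N → Type} [∀ i, Fintype (ι i)]
    (B : ∀ i, Matrix (ι i) (ι i) ℂ) :
    tensor (fun i => (B i)ᴴ * B i) = (tensor B)ᴴ * tensor B := by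
  classical
  ext a b
  simp only [tensor, Matrix.of_apply, Matrix.mul_apply, Matrix.conjTranspose_apply, star_prod,
    ← Finset.prod_mul_distrib]
  rw [Finset.prod_univ_sum, Fintype.piFinset_univ]

/-- A tensor product of Gram matrices `Bᴴ * B` is again a Gram matrix. -/
theorem posSemidef_tensor {N : ℕ} {ι : Fin N → Type} [∀ i, Fintype (ι i)]
    {ρ : ∀ i, Matrix (ι i) (ι i) ℂ} (h : ∀ i, (ρ i).PosSemidef) : (tensor ρ).PosSemidef := by
  classical
  choose B hB using fun i => (h i).exists_eq_conjTranspose_mul_self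
  have : ρ = fun i => (B i)ᴴ * B i := funext hB
  rw [this, tensor_conjTranspose_mul_self]
  exact Matrix.posSemidef_conjTranspose_mul_self _

theorem re_trace_mul_nonneg {ι : Type} [Fintype ι] {A B : Matrix ι ι ℂ} (hA : A.PosSemidef)
    (hB : B.PosSemidef) : 0 ≤ ((A * B).trace).re := by
  classical
  obtain ⟨C, rfl⟩ := hA.exists_eq_conjTranspose_mul_self
  rw [Matrix.mul_assoc, Matrix.trace_mul_comm]
  exact (Complex.nonneg_iff.mp (hB.mul_mul_conjTranspose_same C).trace_nonneg).1

theorem posSemidef_pureState {ι : Type} [Finite ι] (ψ : ι → ℂ) : (pureState ψ).PosSemidef :=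
  Matrix.posSemidef_vecMulVec_self_star ψ

/-! ### Success metric and exclusion error under nonnegative probabilities -/

theorem successMetric_le_one {X : Type} [Fintype X] {N : ℕ} {q : X → ℝ}
    {p : (Fin N → X) → (Fin N → X) → ℝ} (hq : ∀ x, 0 ≤ q x) (hp : ∀ x, 0 ≤ p x x) :
    successMetric q p ≤ 1 :=
  sub_le_self _ (Finset.sum_nonneg fun x _ =>
    mul_nonneg (Finset.prod_nonneg fun i _ => hq (x i)) (hp x))

theorem successMetric_eq_one {X : Type} [Fintype X] {N : ℕ} {q : X → ℝ}
    {p : (Fin N → X) → (Fin N → X) → ℝ} (hp : ∀ x, p x x = 0) : successMetric q p = 1 := by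
  simp [successMetric, hp]

theorem eq_zero_of_successMetric_eq_one {X : Type} [Fintype X] {N : ℕ} {q : X → ℝ}
    {p : (Fin N → X) → (Fin N → X) → ℝ} (hq : ∀ x, 0 < q x) (hp : ∀ x, 0 ≤ p x x)
    (h : successMetric q p = 1) (x : Fin N → X) : p x x = 0 := by
  have hprod (x : Fin N → X) : 0 < ∏ i, q (x i) := Finset.prod_pos fun i _ => hq (x i)
  have h0 : ∑ x : Fin N → X, (∏ i, q (x i)) * p x x = 0 := by
    unfold successMetric at h
    linarith
  have := (Finset.sum_eq_zero_iff_of_nonneg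
    fun x _ => mul_nonneg (hprod x).le (hp x)).mp h0 x (Finset.mem_univ x)
  exact (mul_eq_zero.mp this).resolve_left (hprod x).ne'

theorem exclusionError_nonneg {X Z : Type} [Fintype Z] {q : X → ℝ} {p : X → Z → ℝ}
    (hq : ∀ x, 0 ≤ q x) (hp : ∀ x z, 0 ≤ p x z) : 0 ≤ exclusionError q p :=
  Finset.sum_nonneg fun z _ => Real.iInf_nonneg fun x => mul_nonneg (hq x) (hp x z)

theorem iInf_fin_two (f : Fin 2 → ℝ) : ⨅ x, f x = min (f 0) (f 1) := by
  apply le_antisymm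
  · exact le_min (ciInf_le (Set.finite_range f).bddBelow 0)
      (ciInf_le (Set.finite_range f).bddBelow 1)
  · refine le_ciInf fun x => ?_
    fin_cases x
    · exact min_le_left _ _
    · exact min_le_right _ _

theorem uniformBit_pos (x : Fin 2) : 0 < uniformBit x := by norm_num [uniformBit]

/-! ### Classical messages -/

theorem classicalExclusionErrors_nonneg {X Msg : Type} [Fintype Msg] {q : X → ℝ}
    {e : X → Msg → ℝ} (hq : ∀ x, 0 ≤ q x) (he : ∀ x m, 0 ≤ e x m) {r : ℝ}
    (hr : r ∈ classicalExclusionErrors q e) : 0 ≤ r := by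
  obtain ⟨k, d, hd, rfl⟩ := hr
  exact exclusionError_nonneg hq fun x z =>
    Finset.sum_nonneg fun m _ => mul_nonneg (hd.1 m z) (he x m)

theorem classicalAntiDist_le_one {X Msg : Type} [Fintype Msg] {q : X → ℝ}
    {e : X → Msg → ℝ} (hq : ∀ x, 0 ≤ q x) (he : ∀ x m, 0 ≤ e x m) :
    classicalAntiDist q e ≤ 1 :=
  sub_le_self _ (Real.sInf_nonneg fun _ hr => classicalExclusionErrors_nonneg hq he hr)

/-- If every message rules out one of the two inputs, the inputs are perfectly
anti-distinguishable. -/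
theorem one_le_classicalAntiDist {k : ℕ} {q : Fin 2 → ℝ} {e : Fin 2 → Fin k → ℝ}
    (hq : ∀ x, 0 ≤ q x) (he : ∀ x m, 0 ≤ e x m) (h : ∀ m, e 0 m = 0 ∨ e 1 m = 0) :
    1 ≤ classicalAntiDist q e := by
  have hmem : (0 : ℝ) ∈ classicalExclusionErrors q e := by
    -- Reading out the message itself makes every minimum vanish.
    refine ⟨k, fun m z => if m = z then 1 else 0, ⟨fun m z => ?_, fun m => by simp⟩, ?_⟩
    · dsimp only
      split_ifs <;> norm_num
    · symm
      refine Finset.sum_eq_zero fun z _ => ?_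
      rw [iInf_fin_two]
      simp only [ite_mul, one_mul, zero_mul, Finset.sum_ite_eq', Finset.mem_univ, if_true]
      rcases h z with h | h
      · simpa [h] using mul_nonneg (hq 1) (he 1 z)
      · simpa [h] using mul_nonneg (hq 0) (he 0 z)
  have : sInf (classicalExclusionErrors q e) ≤ 0 :=
    csInf_le ⟨0, fun _ hr => classicalExclusionErrors_nonneg hq he hr⟩ hmem
  unfold classicalAntiDist
  linarith

theorem le_one_of_mem_classicalSuccessValues {X : Type} [Fintype X] [DecidableEq X] {N : ℕ}
    {q : X → ℝ} {A S : ℝ} (hq : ∀ x, 0 ≤ q x) (hS : S ∈ classicalSuccessValues N q A) :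
    S ≤ 1 := by
  obtain ⟨k, e, d, he, hd, -, rfl⟩ := hS
  exact successMetric_le_one hq fun x => Finset.sum_nonneg fun m _ =>
    mul_nonneg (hd.1 _ _) (Finset.prod_nonneg fun i _ => (he i).1 _ _)

/-- Sending the input bit itself and naming its complement is a perfect classical protocol. -/
theorem one_mem_classicalSuccessValues {N : ℕ} (hN : 1 ≤ N) :
    1 ∈ classicalSuccessValues N uniformBit 1 := by
  have hbit : IsStochastic (fun x m : Fin 2 => if m = x then (1 : ℝ) else 0) :=
    ⟨fun x m => by dsimp only; split_ifs <;> norm_num, fun x => by simp⟩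
  refine ⟨fun _ => 2, fun _ x m => if m = x then 1 else 0,
    fun m z => if z = fun i => m i + 1 then 1 else 0, fun _ => hbit,
    ⟨fun m z => by dsimp only; split_ifs <;> norm_num, fun m => by simp⟩,
    fun _ => classicalAntiDist_le_one (fun x => (uniformBit_pos x).le) hbit.1, ?_⟩
  refine (successMetric_eq_one ?_).symm
  refine fun x => Finset.sum_eq_zero fun m _ => ?_
  by_cases hm : m = x
  · subst hm
    -- Addition in `Fin 2` flips every bit; `1 ≤ N` supplies a coordinate where the complement
    -- differs.
    have : m ≠ fun i => m i + 1 := fun h => by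
      have := congrFun h ⟨0, hN⟩
      revert this
      generalize m ⟨0, hN⟩ = b
      fin_cases b <;> simp
    exact mul_eq_zero_of_left (if_neg this) _
  · obtain ⟨i, hi⟩ := Function.ne_iff.mp hm
    rw [Finset.prod_eq_zero (Finset.mem_univ i) (if_neg hi), mul_zero]

/-- Otherwise choose for each sender a message `m i` of positive probability under both inputs. A
perfect decoder would have to give every string probability `0` on the tuple `m`, against
normalisation. -/
theorem one_le_of_one_mem_classicalSuccessValues {N : ℕ} {A : ℝ}
    (h : 1 ∈ classicalSuccessValues N uniformBit A) : 1 ≤ A := by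
  obtain ⟨k, e, d, he, hd, hA, hS⟩ := h
  have hnn (m : ∀ i, Fin (k i)) (x : Fin N → Fin 2) : 0 ≤ d m x * ∏ i, e i (x i) (m i) :=
    mul_nonneg (hd.1 _ _) (Finset.prod_nonneg fun i _ => (he i).1 _ _)
  have hzero (x : Fin N → Fin 2) (m : ∀ i, Fin (k i)) : d m x * ∏ i, e i (x i) (m i) = 0 :=
    (Finset.sum_eq_zero_iff_of_nonneg fun m _ => hnn m x).mp
      (eq_zero_of_successMetric_eq_one uniformBit_pos
        (fun x => Finset.sum_nonneg fun m _ => hnn m x) hS.symm x) m (Finset.mem_univ m)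
  obtain ⟨i, hi⟩ : ∃ i, ∀ m, e i 0 m = 0 ∨ e i 1 m = 0 := by
    by_contra! hcon
    choose m hm using hcon
    have hne (i) (x : Fin 2) : e i x (m i) ≠ 0 := by
      fin_cases x
      · exact (hm i).1
      · exact (hm i).2
    have hd0 (x : Fin N → Fin 2) : d m x = 0 := (mul_eq_zero.mp (hzero x m)).resolve_right
      (Finset.prod_ne_zero_iff.mpr fun i _ => hne i (x i))
    simpa [hd0] using hd.2 m
  exact (one_le_classicalAntiDist (fun x => (uniformBit_pos x).le) (he i).1 hi).trans (hA i)

theorem isLeast_classicalBoundsAchieving_one {N : ℕ} (hN : 1 ≤ N) :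
    IsLeast (classicalBoundsAchieving N uniformBit 1) 1 :=
  ⟨⟨one_mem_classicalSuccessValues hN,
    fun _ => le_one_of_mem_classicalSuccessValues fun x => (uniformBit_pos x).le⟩,
    fun _ hA => one_le_of_one_mem_classicalSuccessValues hA.1⟩

/-! ### Anti-distinguishing two qubit states -/

theorem isDensity_pbrState (θ : ℝ) (x : Fin 2) : IsDensity (pbrState θ x) := by
  refine ⟨posSemidef_pureState _, ?_⟩
  have h : ((Real.cos (θ / 2) : ℝ) : ℂ) ^ 2 + ((Real.sin (θ / 2) : ℝ) : ℂ) ^ 2 = 1 := by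
    exact_mod_cast Real.cos_sq_add_sin_sq (θ / 2)
  rw [← h]
  simp only [pbrState, pureState, Matrix.trace_fin_two, Matrix.vecMulVec_apply, pbrVector,
    Pi.star_apply]
  fin_cases x <;> simp [-Complex.ofReal_cos, -Complex.ofReal_sin] <;> ring

/-- The amplitudes are real, so only the real part of the off-diagonal entry matters, and the input
enters solely through its sign. -/
theorem born_pbrState {Z : Type} (θ : ℝ) {M : Z → Matrix (Fin 2) (Fin 2) ℂ} (z : Z)
    (hM : (M z).PosSemidef) (x : Fin 2) :
    born (pbrState θ) M x z = Real.cos (θ / 2) ^ 2 * (M z 0 0).re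
      + Real.sin (θ / 2) ^ 2 * (M z 1 1).re + (-1) ^ (x : ℕ) * (Real.sin θ * (M z 0 1).re) := by
  have h10 : (M z 1 0).re = (M z 0 1).re := by
    rw [← hM.isHermitian.apply 1 0]
    simp
  have hs : Real.sin θ = 2 * Real.sin (θ / 2) * Real.cos (θ / 2) := by
    rw [← Real.sin_two_mul]
    ring_nf
  rw [hs]
  simp only [born, pbrState, pureState, Matrix.trace_fin_two, Matrix.mul_apply, Fin.sum_univ_two,
    Matrix.vecMulVec_apply, pbrVector, Pi.star_apply]
  fin_cases x <;> simp [-Complex.ofReal_cos, -Complex.ofReal_sin, h10] <;> ring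

theorem abs_re_le_of_posSemidef {M : Matrix (Fin 2) (Fin 2) ℂ} (hM : M.PosSemidef) :
    |(M 0 1).re| ≤ ((M 0 0).re + (M 1 1).re) / 2 := by
  have h10 : (M 1 0).re = (M 0 1).re := by
    rw [← hM.isHermitian.apply 1 0]
    simp
  -- The quadratic form at `(1, ±1)` has real part `Re M₀₀ + Re M₁₁ ± 2 Re M₀₁`.
  have h1 := (Complex.nonneg_iff.mp (hM.dotProduct_mulVec_nonneg ![1, 1])).1
  have h2 := (Complex.nonneg_iff.mp (hM.dotProduct_mulVec_nonneg ![1, -1])).1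
  simp [dotProduct, Matrix.mulVec, Fin.sum_univ_two] at h1 h2
  rw [abs_le]
  constructor <;> linarith

/-- Helstrom bound: in each outcome the off-diagonal term lowers the smaller value by at most `sin θ
/ 4` times the trace of `M z`. The resulting bound is linear in the diagonal entries, each of which
sums to `1` over the outcomes. -/
theorem le_exclusionError_pbrState {Z : Type} [Fintype Z] {θ : ℝ} (hθ : 0 ≤ Real.sin θ)
    {M : Z → Matrix (Fin 2) (Fin 2) ℂ} (hM : IsPOVM M) :
    (1 - Real.sin θ) / 2 ≤ exclusionError uniformBit (born (pbrState θ) M) := by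
  have hsum (i : Fin 2) : ∑ z, (M z i i).re = 1 := by
    have := congrArg (fun B : Matrix (Fin 2) (Fin 2) ℂ => (B i i).re) hM.2
    simpa [Matrix.sum_apply] using this
  have hcs := Real.cos_sq_add_sin_sq (θ / 2)
  calc (1 - Real.sin θ) / 2
      = ∑ z, ((Real.cos (θ / 2) ^ 2 / 2 - Real.sin θ / 4) * (M z 0 0).re
          + (Real.sin (θ / 2) ^ 2 / 2 - Real.sin θ / 4) * (M z 1 1).re) := by
        rw [Finset.sum_add_distrib, ← Finset.mul_sum, ← Finset.mul_sum, hsum, hsum]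
        linarith
    _ ≤ _ := Finset.sum_le_sum fun z _ => ?_
  have habs := abs_le.mp (abs_re_le_of_posSemidef (hM.1 z))
  have h1 := mul_le_mul_of_nonneg_left habs.1 hθ
  have h2 := mul_le_mul_of_nonneg_left habs.2 hθ
  rw [iInf_fin_two, born_pbrState θ z (hM.1 z), born_pbrState θ z (hM.1 z)]
  refine le_min ?_ ?_ <;> simp [uniformBit] <;> linarith

/-- The projections on the vectors `(|0⟩ ∓ |1⟩)/√2`. -/
noncomputable def diagonalPOVM (z : Fin 2) : Matrix (Fin 2) (Fin 2) ℂ :=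
  (1 / 2 : ℂ) • pureState ![1, -(-1) ^ (z : ℕ)]

theorem isPOVM_diagonalPOVM : IsPOVM diagonalPOVM := by
  refine ⟨fun z => (posSemidef_pureState _).smul (by simp), ?_⟩
  ext i j
  simp only [Fin.sum_univ_two, diagonalPOVM, pureState, Matrix.add_apply, Matrix.smul_apply,
    Matrix.vecMulVec_apply]
  fin_cases i <;> fin_cases j <;> simp <;> norm_num

theorem exclusionError_diagonalPOVM {θ : ℝ} (hθ : 0 ≤ Real.sin θ) :
    exclusionError uniformBit (born (pbrState θ) diagonalPOVM) = (1 - Real.sin θ) / 2 := by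
  have hcs := Real.cos_sq_add_sin_sq (θ / 2)
  have hborn (x z : Fin 2) : born (pbrState θ) diagonalPOVM x z
      = (1 - (-1) ^ (x + z : ℕ) * Real.sin θ) / 2 := by
    rw [born_pbrState θ z (isPOVM_diagonalPOVM.1 z)]
    simp only [diagonalPOVM, pureState, Matrix.smul_apply, Matrix.vecMulVec_apply]
    fin_cases x <;> fin_cases z <;> simp [-Complex.ofReal_cos, -Complex.ofReal_sin] <;> linarith
  simp only [exclusionError, iInf_fin_two, Fin.sum_univ_two, hborn, uniformBit]
  -- On outcome `z` the less likely input is `x = z`.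
  rw [min_eq_left, min_eq_right] <;> simp <;> linarith

theorem isLeast_quantumExclusionErrors_pbrState {θ : ℝ} (hθ : 0 ≤ Real.sin θ) :
    IsLeast (quantumExclusionErrors uniformBit (pbrState θ)) ((1 - Real.sin θ) / 2) := by
  refine ⟨⟨2, diagonalPOVM, isPOVM_diagonalPOVM, (exclusionError_diagonalPOVM hθ).symm⟩, ?_⟩
  rintro _ ⟨k, M, hM, rfl⟩
  exact le_exclusionError_pbrState hθ hM

theorem quantumAntiDist_pbrState {θ : ℝ} (hθ : 0 ≤ Real.sin θ) :
    quantumAntiDist uniformBit (pbrState θ) = (1 + Real.sin θ) / 2 := by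
  rw [quantumAntiDist, (isLeast_quantumExclusionErrors_pbrState hθ).csInf_eq]
  ring

/-! ### The measurement that excludes the product states -/

/-- The vector with components `(-1)^(x·z) u z`. -/
noncomputable def signTwist {N : ℕ} (u : (Fin N → Fin 2) → ℂ) (x z : Fin N → Fin 2) : ℂ :=
  (∏ i, (-1) ^ ((x i : ℕ) * (z i : ℕ))) * u z

/-- Orthogonality of the characters of `(ℤ/2)^N`: the sum factors over coordinates, and a coordinate
where `a` and `b` differ contributes `1 - 1`. -/
theorem sum_prod_sign_mul_sign {N : ℕ} (a b : Fin N → Fin 2) :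
    ∑ x : Fin N → Fin 2, (∏ i, (-1 : ℂ) ^ ((x i : ℕ) * (a i : ℕ)))
      * ∏ i, (-1 : ℂ) ^ ((x i : ℕ) * (b i : ℕ)) = if a = b then 2 ^ N else 0 := by
  simp only [← Finset.prod_mul_distrib]
  have hfac (i : Fin N) : ∑ y : Fin 2, (-1 : ℂ) ^ ((y : ℕ) * (a i : ℕ))
      * (-1) ^ ((y : ℕ) * (b i : ℕ)) = if a i = b i then 2 else 0 := by
    generalize a i = c
    generalize b i = d
    fin_cases c <;> fin_cases d <;> norm_num
  rw [← Fintype.piFinset_univ, ← Finset.prod_univ_sum (fun _ => Finset.univ)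
    (fun i (y : Fin 2) => (-1 : ℂ) ^ ((y : ℕ) * (a i : ℕ)) * (-1) ^ ((y : ℕ) * (b i : ℕ)))]
  simp only [hfac]
  split_ifs with hab
  · simp [hab]
  · obtain ⟨i, hi⟩ := Function.ne_iff.mp hab
    exact Finset.prod_eq_zero (Finset.mem_univ i) (if_neg hi)

/-- The sign twists of a vector of phases form an orthogonal basis. -/
theorem isPOVM_signTwist {N : ℕ} {u : (Fin N → Fin 2) → ℂ} (hu : ∀ z, ‖u z‖ = 1) :
    IsPOVM fun x => (1 / 2 ^ N : ℂ) • pureState (signTwist u x) := by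
  refine ⟨fun x => (posSemidef_pureState _).smul ?_, ?_⟩
  · have : (1 / 2 ^ N : ℂ) = ((1 / 2 ^ N : ℝ) : ℂ) := by push_cast; rfl
    rw [this]
    exact Complex.zero_le_real.mpr (by positivity)
  ext a b
  have hterm (x : Fin N → Fin 2) : signTwist u x a * star (signTwist u x b)
      = u a * star (u b) * ((∏ i, (-1 : ℂ) ^ ((x i : ℕ) * (a i : ℕ)))
        * ∏ i, (-1 : ℂ) ^ ((x i : ℕ) * (b i : ℕ))) := by
    simp only [signTwist, star_mul', star_prod, star_pow, star_neg, star_one]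
    ring
  simp only [Matrix.smul_apply, Matrix.sum_apply, pureState,
    Matrix.vecMulVec_apply, Pi.star_apply, hterm, ← Finset.mul_sum, sum_prod_sign_mul_sign,
    Matrix.one_apply, smul_eq_mul]
  split_ifs with hab
  · subst hab
    have : u a * star (u a) = 1 := by
      rw [Complex.star_def, Complex.mul_conj, Complex.normSq_eq_norm_sq, hu]
      norm_num
    rw [this]
    field_simp
  · simp

theorem pbrProduct_eq_pureState {N : ℕ} (θ : ℝ) (x : Fin N → Fin 2) :
    pbrProduct θ x = pureState fun z => ∏ i, pbrVector θ (x i) (z i) := by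
  ext a b
  simp [pbrProduct, tensor, pbrState, pureState, Matrix.vecMulVec_apply, Finset.prod_mul_distrib]

theorem pbrVector_eq_sign_mul (θ : ℝ) (x z : Fin 2) :
    pbrVector θ x z = (-1) ^ ((x : ℕ) * (z : ℕ)) * pbrVector θ 0 z := by
  fin_cases z <;> simp [pbrVector]

/-- The state and the twisted vector carry the same signs, which square to `1`, so every overlap
reduces to the one for `x = 0`. The amplitudes are real, hence no conjugate in `hu`. -/
theorem trace_pbrProduct_mul_signTwist {N : ℕ} {θ : ℝ} {u : (Fin N → Fin 2) → ℂ}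
    (hu : ∑ z, (∏ i, pbrVector θ 0 (z i)) * u z = 0) (x : Fin N → Fin 2) :
    (pbrProduct θ x * ((1 / 2 ^ N : ℂ) • pureState (signTwist u x))).trace = 0 := by
  have hreal (z : Fin 2) : star (pbrVector θ 0 z) = pbrVector θ 0 z := by
    fin_cases z <;> simp [pbrVector, -Complex.ofReal_cos, -Complex.ofReal_sin]
  have hdot : star (fun z => ∏ i, pbrVector θ (x i) (z i)) ⬝ᵥ signTwist u x = 0 := by
    rw [← hu]
    refine Finset.sum_congr rfl fun z _ => ?_
    have hsq : (∏ i, (-1 : ℂ) ^ ((x i : ℕ) * (z i : ℕ)))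
        * ∏ i, (-1 : ℂ) ^ ((x i : ℕ) * (z i : ℕ)) = 1 := by
      rw [← Finset.prod_mul_distrib]
      refine Finset.prod_eq_one fun i _ => ?_
      rw [← mul_pow]
      norm_num
    simp only [Pi.star_apply, star_prod, signTwist]
    simp only [pbrVector_eq_sign_mul θ (x _), star_mul', hreal, star_pow, star_neg, star_one,
      Finset.prod_mul_distrib]
    linear_combination (∏ i, pbrVector θ 0 (z i)) * u z * hsq
  rw [pbrProduct_eq_pureState, Matrix.mul_smul, pureState, pureState,
    Matrix.vecMulVec_mul_vecMulVec, hdot]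
  simp

/-- Intermediate value theorem on the unit circle: the modulus is at least `1` at `w = 1`, because
`2 ≤ (1 + t) ^ N`, and at most `1` at `w = -1`, because `0 ≤ 1 - t ≤ 1`. -/
theorem exists_norm_one_add_mul_pow_sub_one_eq_one {N : ℕ} {t : ℝ} (ht₀ : 0 ≤ t) (ht₁ : t ≤ 1)
    (h : 2 ≤ (1 + t) ^ N) : ∃ w : ℂ, ‖w‖ = 1 ∧ ‖(1 + t * w) ^ N - 1‖ = 1 := by
  let f : ℝ → ℝ := fun α => ‖(1 + t * Complex.exp (α * Complex.I)) ^ N - 1‖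
  have hf : Continuous f := by fun_prop
  have h0 : 1 ≤ f 0 := by
    have : f 0 = ‖(((1 + t) ^ N - 1 : ℝ) : ℂ)‖ := by simp [f]
    rw [this, Complex.norm_real, Real.norm_eq_abs]
    exact le_trans (by linarith) (le_abs_self _)
  have hpi : f Real.pi ≤ 1 := by
    have : f Real.pi = ‖(((1 - t) ^ N - 1 : ℝ) : ℂ)‖ := by
      simp [f, Complex.exp_pi_mul_I, sub_eq_add_neg]
    rw [this, Complex.norm_real, Real.norm_eq_abs, abs_le]
    have h1 : 0 ≤ (1 - t) ^ N := pow_nonneg (by linarith) N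
    have h2 : (1 - t) ^ N ≤ 1 := pow_le_one₀ (by linarith) (by linarith)
    constructor <;> linarith
  obtain ⟨α, hα⟩ := mem_range_of_exists_le_of_exists_ge hf ⟨_, hpi⟩ ⟨_, h0⟩
  exact ⟨_, Complex.norm_exp_ofReal_mul_I α, hα⟩

theorem exists_phases_sum_eq_zero {N : ℕ} {θ : ℝ} (hcos : 0 < Real.cos (θ / 2))
    (ht₀ : 0 ≤ Real.tan (θ / 2)) (ht₁ : Real.tan (θ / 2) ≤ 1)
    (h : 2 ≤ (1 + Real.tan (θ / 2)) ^ N) :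
    ∃ u : (Fin N → Fin 2) → ℂ, (∀ z, ‖u z‖ = 1) ∧
      ∑ z, (∏ i, pbrVector θ 0 (z i)) * u z = 0 := by
  obtain ⟨w, hw, hw'⟩ := exists_norm_one_add_mul_pow_sub_one_eq_one ht₀ ht₁ h
  set t := Real.tan (θ / 2) with ht
  have hs : Real.sin (θ / 2) = Real.cos (θ / 2) * t := by
    rw [ht, Real.tan_eq_sin_div_cos]
    field_simp
  let g : (Fin N → Fin 2) → ℂ := fun z => ∏ i, w ^ (z i : ℕ)
  -- Up to the factor `cos (θ / 2) ^ N`, the phases `w ^ |z|` at `z ≠ 0` contribute `(1 + t * w) ^ N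
  -- - 1` by the binomial expansion. The entry at `0` cancels this, and it is a phase by the choice
  -- of `w`.
  refine ⟨Function.update g 0 (1 - (1 + t * w) ^ N), fun z => ?_, ?_⟩
  · by_cases hz : z = 0
    · rw [hz, Function.update_self, norm_sub_rev, hw']
    · rw [Function.update_of_ne hz]
      simp [g, hw]
  · have hg : ∑ z, (∏ i, pbrVector θ 0 (z i)) * g z
        = (Real.cos (θ / 2) : ℂ) ^ N * (1 + t * w) ^ N := by
      simp only [g, ← Finset.prod_mul_distrib]
      rw [← Fintype.piFinset_univ, ← Finset.prod_univ_sum (fun _ => Finset.univ)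
        (fun _ (y : Fin 2) => pbrVector θ 0 y * w ^ (y : ℕ))]
      simp only [Fin.sum_univ_two, pbrVector, hs, Finset.prod_const, Finset.card_univ,
        Fintype.card_fin, ← mul_pow]
      congr 1
      simp [-Complex.ofReal_cos]
      ring
    have h0 : ∏ i : Fin N, pbrVector θ 0 ((0 : Fin N → Fin 2) i)
        = (Real.cos (θ / 2) : ℂ) ^ N := by simp [pbrVector]
    have hg0 : g 0 = 1 := by simp [g]
    rw [← Finset.add_sum_erase _ _ (Finset.mem_univ 0), hg0, h0] at hg
    rw [← Finset.add_sum_erase _ _ (Finset.mem_univ 0), Function.update_self, h0,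
      Finset.sum_congr rfl fun z hz => by
        rw [Function.update_of_ne (Finset.ne_of_mem_erase hz)]]
    linear_combination hg

theorem exists_isPOVM_trace_pbrProduct_mul_eq_zero {N : ℕ} {θ : ℝ}
    (hcos : 0 < Real.cos (θ / 2)) (ht₀ : 0 ≤ Real.tan (θ / 2)) (ht₁ : Real.tan (θ / 2) ≤ 1)
    (h : 2 ≤ (1 + Real.tan (θ / 2)) ^ N) :
    ∃ M : (Fin N → Fin 2) → Matrix (Fin N → Fin 2) (Fin N → Fin 2) ℂ,
      IsPOVM M ∧ ∀ x, (pbrProduct θ x * M x).trace = 0 := by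
  obtain ⟨u, hu, hsum⟩ := exists_phases_sum_eq_zero hcos ht₀ ht₁ h
  exact ⟨_, isPOVM_signTwist hu, trace_pbrProduct_mul_signTwist hsum⟩

/-! ### Upper bound on quantum protocols, the threshold angle, and the main theorem -/

theorem successMetric_born_tensor_le_one {X : Type} [Fintype X] {N : ℕ} {ι : Fin N → Type}
    [∀ i, Fintype (ι i)] [DecidableEq (∀ i, ι i)] {q : X → ℝ} (hq : ∀ x, 0 ≤ q x)
    {ρ : ∀ i, X → Matrix (ι i) (ι i) ℂ} (hρ : ∀ i x, IsDensity (ρ i x))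
    {M : (Fin N → X) → Matrix (∀ i, ι i) (∀ i, ι i) ℂ} (hM : ∀ x, (M x).PosSemidef) :
    successMetric q (born (fun x => tensor fun i => ρ i (x i)) M) ≤ 1 :=
  successMetric_le_one hq fun x =>
    re_trace_mul_nonneg (posSemidef_tensor fun i => (hρ i (x i)).1) (hM x)

/-- Since `tan` is increasing on `(-π/2, π/2)`, the threshold on `θ` says `2 ^ (1 / N) ≤ 1 + tan (θ
/ 2)`. -/
theorem two_le_one_add_tan_pow {N : ℕ} (hN : N ≠ 0) {θ : ℝ}
    (hθ₁ : 2 * Real.arctan ((2 : ℝ) ^ (1 / (N : ℝ)) - 1) ≤ θ) (hθ₂ : θ < Real.pi / 2) :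
    2 ≤ (1 + Real.tan (θ / 2)) ^ N := by
  have hle : (2 : ℝ) ^ (1 / (N : ℝ)) - 1 ≤ Real.tan (θ / 2) := by
    rw [← Real.tan_arctan ((2 : ℝ) ^ (1 / (N : ℝ)) - 1)]
    refine Real.strictMonoOn_tan.monotoneOn (Real.arctan_mem_Ioo _)
      ⟨?_, ?_⟩ (by linarith)
    · linarith [Real.neg_pi_div_two_lt_arctan ((2 : ℝ) ^ (1 / (N : ℝ)) - 1)]
    · linarith [Real.pi_pos]
  calc (2 : ℝ) = ((2 : ℝ) ^ (1 / (N : ℝ))) ^ N := by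
        rw [one_div, Real.rpow_inv_natCast_pow (by norm_num) hN]
    _ ≤ _ := pow_le_pow_left₀ (by positivity) (by linarith) N

theorem theorem2 (N : ℕ) (hN : 1 ≤ N) (θ : ℝ)
    (hθ₁ : 2 * Real.arctan ((2 : ℝ) ^ (1 / (N : ℝ)) - 1) ≤ θ) (hθ₂ : θ < Real.pi / 2) :
    -- the messages are qubit states
    (∀ x, IsDensity (pbrState θ x)) ∧
    -- the product states are perfectly anti-distinguishable
    (∃ M : (Fin N → Fin 2) → Matrix (Fin N → Fin 2) (Fin N → Fin 2) ℂ,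
      IsPOVM M ∧ ∀ x, (pbrProduct θ x * M x).trace = 0) ∧
    -- the best success metric with these states is 1
    IsGreatest {S : ℝ | ∃ M : (Fin N → Fin 2) → Matrix (Fin N → Fin 2) (Fin N → Fin 2) ℂ,
      IsPOVM M ∧ S = successMetric uniformBit (born (pbrProduct θ) M)} 1 ∧
    -- the anti-distinguishability of each sender's inputs, as an attained optimum
    IsLeast (quantumExclusionErrors uniformBit (pbrState θ)) ((1 - Real.sin θ) / 2) ∧
    quantumAntiDist uniformBit (pbrState θ) = (1 + Real.sin θ) / 2 ∧
    -- the best quantum value under this bound on the anti-distinguishability is 1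
    IsGreatest (quantumSuccessValues N uniformBit
      (quantumAntiDist uniformBit (pbrState θ))) 1 ∧
    -- classically, the anti-distinguishability has to be 1 to reach this value, and 1 suffices
    IsLeast (classicalBoundsAchieving N uniformBit 1) 1 ∧
    requiredClassicalAntiDist N uniformBit 1 = 1 ∧
    -- the advantage
    (requiredClassicalAntiDist N uniformBit 1 / quantumAntiDist uniformBit (pbrState θ)) ^ N =
      (2 / (1 + Real.sin θ)) ^ N ∧
    1 < (2 / (1 + Real.sin θ)) ^ N := by
  have hN0 : N ≠ 0 := by omega
  have hθ₀ : 0 ≤ θ := by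
    have : 0 ≤ Real.arctan ((2 : ℝ) ^ (1 / (N : ℝ)) - 1) :=
      Real.arctan_nonneg.mpr (sub_nonneg.mpr (Real.one_le_rpow (by norm_num) (by positivity)))
    linarith
  have hpi := Real.pi_pos
  have hsin₀ : 0 ≤ Real.sin θ := Real.sin_nonneg_of_nonneg_of_le_pi hθ₀ (by linarith)
  have hsin₁ : Real.sin θ < 1 := by
    rw [← Real.sin_pi_div_two]
    exact Real.sin_lt_sin_of_lt_of_le_pi_div_two (by linarith) le_rfl hθ₂
  have ht₁ : Real.tan (θ / 2) ≤ 1 := by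
    rw [← Real.tan_pi_div_four]
    exact Real.strictMonoOn_tan.monotoneOn ⟨by linarith, by linarith⟩
      ⟨by linarith, by linarith⟩ (by linarith)
  obtain ⟨M, hM, hM0⟩ := exists_isPOVM_trace_pbrProduct_mul_eq_zero (N := N)
    (Real.cos_pos_of_mem_Ioo ⟨by linarith, by linarith⟩)
    (Real.tan_nonneg_of_nonneg_of_le_pi_div_two (x := θ / 2) (by linarith) (by linarith)) ht₁
    (two_le_one_add_tan_pow hN0 hθ₁ hθ₂)
  have hq (x : Fin 2) : 0 ≤ uniformBit x := (uniformBit_pos x).le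
  have hone : 1 = successMetric uniformBit (born (pbrProduct θ) M) :=
    (successMetric_eq_one fun x => by rw [born, hM0, Complex.zero_re]).symm
  have hC := isLeast_classicalBoundsAchieving_one hN
  have hreq : requiredClassicalAntiDist N uniformBit 1 = 1 := hC.csInf_eq
  refine ⟨isDensity_pbrState θ, ⟨M, hM, hM0⟩, ⟨⟨M, hM, hone⟩, ?_⟩,
    isLeast_quantumExclusionErrors_pbrState hsin₀, quantumAntiDist_pbrState hsin₀,
    ⟨⟨fun _ => 2, fun _ => pbrState θ, M, fun _ => isDensity_pbrState θ, hM,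
      fun _ => le_rfl, hone⟩, ?_⟩, hC, hreq, ?_, ?_⟩
  · rintro _ ⟨M', hM', rfl⟩
    exact successMetric_born_tensor_le_one hq (fun _ => isDensity_pbrState θ) hM'.1
  · rintro _ ⟨k, ρ, M', hρ, hM', -, rfl⟩
    exact successMetric_born_tensor_le_one hq hρ hM'.1
  · rw [hreq, quantumAntiDist_pbrState hsin₀, one_div_div]
  -- The advantage is strict because `θ < π / 2` keeps `sin θ` below `1`.
  · exact one_lt_pow₀ ((one_lt_div (by linarith)).mpr (by linarith)) hN0
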